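/- For $k\in\mathbb{Z}$ let $A(k)=\begin{pmatrix}1&k\\0&1\end{pmatrix}$ and $B(k)=\begin{pmatrix}1&0\\k&1\end{pmatrix}$, and for $M=(m_{ij})\in SL_2(\mathbb{Z})$ let $|M|=\sum_{i,j}|m_{ij}|$ be the complexity of $M$. A \emph{greedy peak reduction run} on $M\in SL_2(\mathbb{Z})$ repeatedly multiplies the current matrix, on the left or on the right, by one of $A(k)^{\pm1},B(k)^{\pm1}$ so that its complexity strictly decreases, for as long as it is possible. If the run ends at the identity matrix, its result is "yes" together with the group word for $M$ that is read off from the multiplications made; if it ends at any other matrix, its result is "no". Let $k\ge 2$ be an integer. Then: 1. Every greedy peak reduction run on every $M\in SL_2(\mathbb{Z})$ gives a correct result: the result is "yes" if and only if $M$ lies in the subgroup $\langle A(k),B(k)\rangle$ of $SL_2(\mathbb{Z})$, and in this case the resulting group word in $A(k),B(k)$ is equal to $M$. 2. There are a multi-stack (equivalently, up to constant factors, multitape) Turing machine $T$ and a constant $C$, both depending only on $k$, such that for every $M\in SL_2(\mathbb{Z})$, given by its entries in binary, $T$ decides whether $M\in\langle A(k),B(k)\rangle$, and if so outputs a group word in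 $A(k),B(k)$ that is equal to $M$; its output is the result of a greedy peak reduction run on $M$, and it halts after at most $C\,n\log n$ steps, where $n=|M|$. -/

import Mathlib

open scoped MatrixGroups

namespace SanovMembership

/-- The matrix `A(k)`, with rows `(1, k)` and `(0, 1)`. -/
def A (k : ℤ) : SL(2, ℤ) := ⟨!![1, k; 0, 1], by simp [Matrix.det_fin_two]⟩

/-- The matrix `B(k)`, with rows `(1, 0)` and `(k, 1)`. -/
def B (k : ℤ) : SL(2, ℤ) := ⟨!![1, 0; k, 1], by simp [Matrix.det_fin_two]⟩

/-- The complexity `|M|`: the sum of the absolute values of the entries of `M`. -/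
def size (M : SL(2, ℤ)) : ℕ := ∑ i : Fin 2, ∑ j : Fin 2, (M.1 i j).natAbs

/-- The letters of group words in two generators, with the convention of `FreeGroup (Fin 2)`:
`(i, true)` is the `i`-th generator and `(i, false)` is its formal inverse. -/
abbrev Letter : Type := Fin 2 × Bool

/-- The value of a letter: generator `0` is `A(k)`, generator `1` is `B(k)`. -/
def letterVal (k : ℤ) (x : Letter) : SL(2, ℤ) :=
  if x.2 then ![A k, B k] x.1 else (![A k, B k] x.1)⁻¹

/-- The value of a group word in `A(k)` and `B(k)`. -/
def wordVal (k : ℤ) (w : List Letter) : SL(2, ℤ) := (w.map (letterVal k)).prod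

/-- `r` is a correct answer to the membership search problem for `M` and the subgroup generated
by `A(k)` and `B(k)`: `none` means "not in the subgroup", `some w` means "in the subgroup,
and `w` is a word that presents `M`". -/
def IsAnswer (k : ℤ) (M : SL(2, ℤ)) (r : Option (List Letter)) : Prop :=
  (r.isSome ↔ M ∈ Subgroup.closure {A k, B k}) ∧ ∀ w, r = some w → wordVal k w = M

/-- `GreedyRun k M r`: some complete run of greedy peak reduction on `M` ends with the result `r`.
A step multiplies the current matrix, on the left or on the right, by one of `A(k)^{±1}`,
`B(k)^{±1}`, and has to reduce the complexity. The run ends with "no" at a matrix other than the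
identity that no such multiplication reduces; it ends with "yes" at the identity, and then the
letters that were removed on the left and on the right are put together to a word. -/
inductive GreedyRun (k : ℤ) : SL(2, ℤ) → Option (List Letter) → Prop
  | one : GreedyRun k 1 (some [])
  | stuck (M : SL(2, ℤ)) (hM : M ≠ 1)
      (h : ∀ x : Letter, size M ≤ size (letterVal k x * M) ∧ size M ≤ size (M * letterVal k x)) :
      GreedyRun k M none
  | left (M : SL(2, ℤ)) (x : Letter) (r : Option (List Letter))
      (h : size ((letterVal k x)⁻¹ * M) < size M)
      (hr : GreedyRun k ((letterVal k x)⁻¹ * M) r) :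
      GreedyRun k M (r.map fun w => x :: w)
  | right (M : SL(2, ℤ)) (x : Letter) (r : Option (List Letter))
      (h : size (M * (letterVal k x)⁻¹) < size M)
      (hr : GreedyRun k (M * (letterVal k x)⁻¹) r) :
      GreedyRun k M (r.map fun w => w ++ [x])

open Computability in
/-- Binary notation of an integer: one symbol for the sign (`true` for negative integers), then
the binary digits of the absolute value, the most significant digit first. -/
def encodeInt (z : ℤ) : List Γ' :=
  Γ'.bit (decide (z < 0)) :: (Nat.bits z.natAbs).reverse.map Γ'.bit

open Computability in
/-- The input string of a matrix: the entries `m₁₁, m₁₂, m₂₁, m₂₂` in binary notation, each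
followed by a comma. -/
def encodeMatrix (M : SL(2, ℤ)) : List Γ' :=
  encodeInt (M.1 0 0) ++ Γ'.comma :: (encodeInt (M.1 0 1) ++ Γ'.comma ::
    (encodeInt (M.1 1 0) ++ Γ'.comma :: (encodeInt (M.1 1 1) ++ [Γ'.comma])))

/-- The output string: the symbol "no", or the symbol "yes" followed by the word, letter by
letter. -/
def encodeResult : Option (List Letter) → List (Bool ⊕ Letter)
  | none => [Sum.inl false]
  | some w => Sum.inl true :: w.map Sum.inr

/-- The Turing machine `T` (Mathlib's machines with finitely many stacks, a finite control and
finite alphabets), started on the input string of `M`, halts with the output string of `r` after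
at most `t` steps. -/
def HaltsWithin (T : Turing.TM2ComputableAux Computability.Γ' (Bool ⊕ Letter))
    (M : SL(2, ℤ)) (r : Option (List Letter)) (t : ℕ) : Prop :=
  Nonempty (Turing.TM2OutputsInTime T.tm ((encodeMatrix M).map T.inputAlphabet.symm)
    (some ((encodeResult r).map T.outputAlphabet.symm)) t)

end SanovMembership

namespace SanovMembership

/-! ### Ping-pong -/

theorem A_mul_apply (m : ℤ) (M : SL(2, ℤ)) (j : Fin 2) :
    (A m * M).1 0 j = M.1 0 j + m * M.1 1 j ∧ (A m * M).1 1 j = M.1 1 j := by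
  change ((A m).1 * M.1) 0 j = _ ∧ ((A m).1 * M.1) 1 j = _
  simp [A, Matrix.mul_apply, Fin.sum_univ_two]

theorem B_mul_apply (m : ℤ) (M : SL(2, ℤ)) (j : Fin 2) :
    (B m * M).1 0 j = M.1 0 j ∧ (B m * M).1 1 j = m * M.1 0 j + M.1 1 j := by
  change ((B m).1 * M.1) 0 j = _ ∧ ((B m).1 * M.1) 1 j = _
  simp [B, Matrix.mul_apply, Fin.sum_univ_two]

theorem ext_entries {M N : SL(2, ℤ)} (h0 : ∀ j, M.1 0 j = N.1 0 j) (h1 : ∀ j, M.1 1 j = N.1 1 j) :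
    M = N :=
  Subtype.ext (Matrix.ext fun i j => by fin_cases i <;> simp [h0, h1])

theorem A_mul_A (m n : ℤ) : A m * A n = A (m + n) := by
  apply ext_entries <;> intro j <;> simp only [A_mul_apply] <;> fin_cases j <;> simp [A, add_comm]

theorem B_mul_B (m n : ℤ) : B m * B n = B (m + n) := by
  apply ext_entries <;> intro j <;> simp only [B_mul_apply] <;> fin_cases j <;> simp [B]

theorem A_zero : A 0 = 1 := by
  apply ext_entries <;> intro j <;> fin_cases j <;> simp [A]

theorem B_zero : B 0 = 1 := by
  apply ext_entries <;> intro j <;> fin_cases j <;> simp [B]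

theorem A_inv (m : ℤ) : (A m)⁻¹ = A (-m) := by
  rw [inv_eq_iff_mul_eq_one, A_mul_A, add_neg_cancel, A_zero]

theorem B_inv (m : ℤ) : (B m)⁻¹ = B (-m) := by
  rw [inv_eq_iff_mul_eq_one, B_mul_B, add_neg_cancel, B_zero]

/-- Alternating products of nontrivial powers of `A k` and `B k`; the index records the generator
of the first syllable. -/
inductive Alternating (k : ℤ) : Option (Fin 2) → SL(2, ℤ) → Prop
  | one : Alternating k none 1
  | mulA {i : Option (Fin 2)} {M : SL(2, ℤ)} (m : ℤ) (hm : m ≠ 0) (hi : i ≠ some 0)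
      (h : Alternating k i M) : Alternating k (some 0) (A (m * k) * M)
  | mulB {i : Option (Fin 2)} {M : SL(2, ℤ)} (m : ℤ) (hm : m ≠ 0) (hi : i ≠ some 1)
      (h : Alternating k i M) : Alternating k (some 1) (B (m * k) * M)

theorem Alternating.exists_A_mul {k : ℤ} {i : Option (Fin 2)} {M : SL(2, ℤ)}
    (h : Alternating k i M) (e : ℤ) (he : e ≠ 0) : ∃ i', Alternating k i' (A (e * k) * M) := by
  cases h with
  | one => exact ⟨_, .mulA e he (by simp) .one⟩
  | @mulA i' N m hm hi h' =>
    rw [← mul_assoc, A_mul_A, ← add_mul]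
    by_cases h0 : e + m = 0
    · rw [h0, zero_mul, A_zero, one_mul]; exact ⟨_, h'⟩
    · exact ⟨_, .mulA _ h0 hi h'⟩
  | mulB m hm hi h' => exact ⟨_, .mulA e he (by simp) (.mulB m hm hi h')⟩

theorem Alternating.exists_B_mul {k : ℤ} {i : Option (Fin 2)} {M : SL(2, ℤ)}
    (h : Alternating k i M) (e : ℤ) (he : e ≠ 0) : ∃ i', Alternating k i' (B (e * k) * M) := by
  cases h with
  | one => exact ⟨_, .mulB e he (by simp) .one⟩
  | @mulB i' N m hm hi h' =>
    rw [← mul_assoc, B_mul_B, ← add_mul]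
    by_cases h0 : e + m = 0
    · rw [h0, zero_mul, B_zero, one_mul]; exact ⟨_, h'⟩
    · exact ⟨_, .mulB _ h0 hi h'⟩
  | mulA m hm hi h' => exact ⟨_, .mulB e he (by simp) (.mulA m hm hi h')⟩

theorem exists_alternating {k : ℤ} {M : SL(2, ℤ)} (hM : M ∈ Subgroup.closure {A k, B k}) :
    ∃ i, Alternating k i M := by
  induction hM using Subgroup.closure_induction_left with
  | one => exact ⟨_, .one⟩
  | mul_left x hx y hy ih =>
    obtain ⟨i, hi⟩ := ih
    rcases hx with rfl | rfl
    · simpa using hi.exists_A_mul 1 one_ne_zero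
    · simpa using hi.exists_B_mul 1 one_ne_zero
  | inv_mul_cancel x hx y hy ih =>
    obtain ⟨i, hi⟩ := ih
    rcases hx with rfl | rfl
    · simpa [A_inv] using hi.exists_A_mul (-1) (by simp)
    · simpa [B_inv] using hi.exists_B_mul (-1) (by simp)

theorem dominates_add {k x y m : ℤ} (hk : 2 ≤ k) (hm : m ≠ 0) (h : k * |x| < 2 * |y|) :
    k * |y| < 2 * |x + m * k * y| := by
  have h1 : |m * k * y| ≤ |x + m * k * y| + |x| := by
    have := abs_sub (x + m * k * y) x
    rwa [add_sub_cancel_left] at this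
  have h2 : |m * k * y| = |m| * (k * |y|) := by
    rw [mul_assoc, abs_mul, abs_mul, abs_of_nonneg (by lia : 0 ≤ k)]
  have h3 : 1 ≤ |m| := Int.one_le_abs hm
  have h4 : 0 ≤ k * |y| := by positivity
  have h5 : 2 * |x| ≤ k * |x| := by gcongr
  have h6 : 2 * |y| ≤ k * |y| := by gcongr
  nlinarith

/-- Row `i` of `M` dominates the other row by a factor of more than `k / 2`. -/
def Dominates (k : ℤ) (M : SL(2, ℤ)) (i : Fin 2) : Prop :=
  ∀ j, k * |M.1 (i + 1) j| < 2 * |M.1 i j|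

theorem Alternating.dominates {k : ℤ} (hk : 2 ≤ k) {i : Option (Fin 2)} {M : SL(2, ℤ)}
    (h : Alternating k i M) : (i = none ∧ M = 1) ∨ ∃ i', i = some i' ∧ Dominates k M i' := by
  induction h with
  | one => exact .inl ⟨rfl, rfl⟩
  | @mulA i N m hm hi h' ih =>
    refine .inr ⟨0, rfl, fun j => ?_⟩
    simp only [zero_add, A_mul_apply]
    rcases ih with ⟨-, rfl⟩ | ⟨i', rfl, hd⟩
    · fin_cases j
      · simp
      · simpa using dominates_add (x := 0) (y := 1) hk hm (by simp)
    · obtain rfl : i' = 1 := by fin_cases i' <;> simp_all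
      exact dominates_add hk hm (hd j)
  | @mulB i N m hm hi h' ih =>
    refine .inr ⟨1, rfl, fun j => ?_⟩
    simp only [Fin.reduceAdd, B_mul_apply, add_comm (_ * _) (N.1 1 j)]
    rcases ih with ⟨-, rfl⟩ | ⟨i', rfl, hd⟩
    · fin_cases j
      · simpa using dominates_add (x := 0) (y := 1) hk hm (by simp)
      · simp
    · obtain rfl : i' = 0 := by fin_cases i' <;> simp_all
      exact dominates_add hk hm (hd j)

/-! ### Entrywise reduction -/

/-- `N` is entrywise at most `M` in absolute value, and smaller in some entry. -/
def Shrinks (N M : Matrix (Fin 2) (Fin 2) ℤ) : Prop :=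
  (∀ i j, |N i j| ≤ |M i j|) ∧ ∃ i j, |N i j| < |M i j|

theorem Shrinks.size_lt {N M : SL(2, ℤ)} (h : Shrinks N.1 M.1) : size N < size M := by
  obtain ⟨h, i, j, hij⟩ := h
  have h' : ∀ i j, (N.1 i j).natAbs ≤ (M.1 i j).natAbs := fun i j =>
    Int.natAbs_le_iff_sq_le.2 (sq_le_sq.2 (h i j))
  exact Finset.sum_lt_sum (fun i _ => Finset.sum_le_sum fun j _ => h' i j)
    ⟨i, Finset.mem_univ _, Finset.sum_lt_sum (fun j _ => h' i j) ⟨j, Finset.mem_univ _,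
      Int.natAbs_lt_iff_sq_lt.2 (sq_lt_sq.2 hij)⟩⟩

theorem letterVal_flip (k : ℤ) (x : Letter) : letterVal k (x.1, !x.2) = (letterVal k x)⁻¹ := by
  obtain ⟨i, b⟩ := x
  cases b <;> simp [letterVal]

theorem letterVal_mem (k : ℤ) (x : Letter) : letterVal k x ∈ Subgroup.closure {A k, B k} := by
  obtain ⟨i, b⟩ := x
  fin_cases i <;> cases b <;> simp [letterVal] <;> exact Subgroup.subset_closure (by simp)

theorem abs_sub_mul_le {k x y : ℤ} (hk : 0 < k) (h : k * |y| < 2 * |x|) (hxy : 0 ≤ x * y) :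
    |x - k * y| ≤ |x| ∧ (y ≠ 0 → |x - k * y| < |x|) := by
  have key : ∀ {x y : ℤ}, 0 < x → 0 ≤ y → k * y < 2 * x →
      |x - k * y| ≤ |x| ∧ (y ≠ 0 → |x - k * y| < |x|) := by
    intro x y hx hy h
    have hky : 0 ≤ k * y := by positivity
    rw [abs_of_pos hx]
    refine ⟨abs_le.2 ⟨by linarith, by linarith⟩, fun h0 => abs_lt.2 ⟨by linarith, ?_⟩⟩
    have : 0 < k * y := by positivity
    linarith
  have hx : x ≠ 0 := by
    rintro rfl
    have : 0 ≤ k * |y| := by positivity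
    simp only [abs_zero, mul_zero] at h
    lia
  rcases lt_or_gt_of_ne hx with hx | hx
  · have hy : y ≤ 0 := by nlinarith
    rw [abs_of_nonpos hy, abs_of_neg hx] at h
    have := key (x := -x) (y := -y) (by lia) (by lia) h
    rwa [mul_neg, ← neg_sub', abs_neg, abs_neg, neg_ne_zero] at this
  · have hy : 0 ≤ y := by nlinarith
    rw [abs_of_nonneg hy, abs_of_pos hx] at h
    exact key hx hy h

/-- In each row of a matrix of determinant one, the two columns can be reduced simultaneously. -/
theorem exists_sign (M : SL(2, ℤ)) :
    ∃ e : ℤ, (e = 1 ∨ e = -1) ∧ ∀ j, 0 ≤ M.1 0 j * (e * M.1 1 j) := by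
  have hdet : M.1 0 0 * M.1 1 1 - M.1 0 1 * M.1 1 0 = 1 := by
    rw [← Matrix.det_fin_two]; exact M.2
  have h : 0 ≤ (M.1 0 0 * M.1 1 0) * (M.1 0 1 * M.1 1 1) := by
    have : (M.1 0 0 * M.1 1 0) * (M.1 0 1 * M.1 1 1) =
        (M.1 0 1 * M.1 1 0 + 1) * (M.1 0 1 * M.1 1 0) := by
      linear_combination (M.1 0 1 * M.1 1 0) * hdet
    rw [this]
    rcases le_or_gt 0 (M.1 0 1 * M.1 1 0) with h | h
    · positivity
    · exact mul_nonneg_of_nonpos_of_nonpos (by lia) h.le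
  rcases mul_nonneg_iff.1 h with ⟨h0, h1⟩ | ⟨h0, h1⟩
  · exact ⟨1, .inl rfl, fun j => by fin_cases j <;> simpa⟩
  · exact ⟨-1, .inr rfl, fun j => by fin_cases j <;> simpa⟩

theorem Dominates.exists_shrinks {k : ℤ} (hk : 2 ≤ k) {M : SL(2, ℤ)} {i : Fin 2}
    (h : Dominates k M i) : ∃ x : Letter, Shrinks ((letterVal k x)⁻¹ * M).1 M.1 := by
  obtain ⟨e, he, hs⟩ := exists_sign M
  have hdet : M.1 0 0 * M.1 1 1 - M.1 0 1 * M.1 1 0 = 1 := by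
    rw [← Matrix.det_fin_two]; exact M.2
  have habs : |e| = 1 := by rcases he with rfl | rfl <;> simp
  have he0 : e ≠ 0 := by rintro rfl; simp at habs
  have hrow : ∀ i, ∃ j, M.1 i j ≠ 0 := by
    intro i
    by_contra! hz
    fin_cases i <;> simp_all
  fin_cases i
  · have hr : ∀ j, |M.1 0 j - k * (e * M.1 1 j)| ≤ |M.1 0 j| ∧
        (e * M.1 1 j ≠ 0 → |M.1 0 j - k * (e * M.1 1 j)| < |M.1 0 j|) := fun j =>
      abs_sub_mul_le (by lia) (by rw [abs_mul, habs, one_mul]; exact h j) (hs j)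
    refine ⟨(0, decide (e = 1)), ?_⟩
    have hx : (letterVal k (0, decide (e = 1)))⁻¹ = A (-(k * e)) := by
      rcases he with rfl | rfl <;> simp [letterVal, A_inv]
    rw [hx]
    obtain ⟨j, hj⟩ := hrow 1
    refine ⟨fun i j => ?_, 0, j, ?_⟩
    · fin_cases i
      · simpa [A_mul_apply, mul_assoc, ← sub_eq_add_neg] using (hr j).1
      · simp [A_mul_apply]
    · simpa [A_mul_apply, mul_assoc, ← sub_eq_add_neg] using (hr j).2 (mul_ne_zero he0 hj)
  · have hr : ∀ j, |M.1 1 j - k * (e * M.1 0 j)| ≤ |M.1 1 j| ∧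
        (e * M.1 0 j ≠ 0 → |M.1 1 j - k * (e * M.1 0 j)| < |M.1 1 j|) := fun j =>
      abs_sub_mul_le (by lia) (by rw [abs_mul, habs, one_mul]; exact h j)
        (by have := hs j; lia)
    refine ⟨(1, decide (e = 1)), ?_⟩
    have hx : (letterVal k (1, decide (e = 1)))⁻¹ = B (-(k * e)) := by
      rcases he with rfl | rfl <;> simp [letterVal, B_inv]
    rw [hx]
    obtain ⟨j, hj⟩ := hrow 0
    refine ⟨fun i j => ?_, 1, j, ?_⟩
    · fin_cases i
      · simp [B_mul_apply]
      · simpa [B_mul_apply, mul_assoc, ← sub_eq_neg_add] using (hr j).1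
    · simpa [B_mul_apply, mul_assoc, ← sub_eq_neg_add] using (hr j).2 (mul_ne_zero he0 hj)

theorem exists_shrinks {k : ℤ} (hk : 2 ≤ k) {M : SL(2, ℤ)}
    (hM : M ∈ Subgroup.closure {A k, B k}) (h1 : M ≠ 1) :
    ∃ x : Letter, Shrinks ((letterVal k x)⁻¹ * M).1 M.1 := by
  obtain ⟨i, hi⟩ := exists_alternating hM
  rcases hi.dominates hk with ⟨-, h⟩ | ⟨i, -, h⟩
  · exact absurd h h1
  · exact h.exists_shrinks hk

/-! ### Correctness of greedy peak reduction -/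

theorem GreedyRun.isAnswer {k : ℤ} (hk : 2 ≤ k) {M : SL(2, ℤ)} {r : Option (List Letter)}
    (h : GreedyRun k M r) : IsAnswer k M r := by
  induction h with
  | one => exact ⟨by simp [one_mem], by simp [wordVal]⟩
  | stuck M hM h =>
    refine ⟨by
      simp only [Option.isSome_none, Bool.false_eq_true, false_iff]
      intro hmem
      obtain ⟨x, hx⟩ := exists_shrinks hk hmem hM
      have := (h (x.1, !x.2)).1
      rw [letterVal_flip] at this
      exact absurd hx.size_lt this.not_gt, by simp⟩
  | left M x r h hr ih =>
    refine ⟨?_, ?_⟩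
    · rw [Option.isSome_map, ih.1, Subgroup.mul_mem_cancel_left _ (inv_mem (letterVal_mem k x))]
    · intro w hw
      obtain ⟨w', rfl, rfl⟩ := Option.map_eq_some_iff.1 hw
      have := ih.2 w' rfl
      simp only [wordVal, List.map_cons, List.prod_cons] at this ⊢
      rw [this, mul_inv_cancel_left]
  | right M x r h hr ih =>
    refine ⟨?_, ?_⟩
    · rw [Option.isSome_map, ih.1, Subgroup.mul_mem_cancel_right _ (inv_mem (letterVal_mem k x))]
    · intro w hw
      obtain ⟨w', rfl, rfl⟩ := Option.map_eq_some_iff.1 hw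
      have := ih.2 w' rfl
      simp only [wordVal, List.map_append, List.prod_append, List.map_cons, List.map_nil,
        List.prod_singleton] at this ⊢
      rw [this, inv_mul_cancel_right]

theorem exists_greedyRun (k : ℤ) (M : SL(2, ℤ)) : ∃ r, GreedyRun k M r := by
  induction hn : size M using Nat.strong_induction_on generalizing M with
  | _ n ih =>
    subst hn
    by_cases hM : M = 1
    · exact hM ▸ ⟨_, .one⟩
    by_cases hl : ∃ x : Letter, size ((letterVal k x)⁻¹ * M) < size M
    · obtain ⟨x, hx⟩ := hl
      obtain ⟨r, hr⟩ := ih _ hx _ rfl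
      exact ⟨_, .left M x r hx hr⟩
    by_cases hr : ∃ x : Letter, size (M * (letterVal k x)⁻¹) < size M
    · obtain ⟨x, hx⟩ := hr
      obtain ⟨r, hr⟩ := ih _ hx _ rfl
      exact ⟨_, .right M x r hx hr⟩
    push Not at hl hr
    exact ⟨_, .stuck M hM fun x => by
      simpa [letterVal_flip] using And.intro (hl (x.1, !x.2)) (hr (x.1, !x.2))⟩

theorem greedyRun_none {k : ℤ} (hk : 2 ≤ k) {M : SL(2, ℤ)}
    (h : M ∉ Subgroup.closure {A k, B k}) : GreedyRun k M none := by
  obtain ⟨r, hr⟩ := exists_greedyRun k M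
  have := (hr.isAnswer hk).1
  rw [iff_false_right h, Bool.not_eq_true, Option.isSome_eq_false_iff, Option.isNone_iff_eq_none]
    at this
  exact this ▸ hr

/-! ### Signed binary notation -/

/-- The integer with the binary digits `l`, least significant digit first, and the sign digit `t`
of weight `2 ^ l.length`. -/
def digitsVal (l : List SignType) (t : ℤ) : ℤ := l.foldr (fun d v => (d : ℤ) + 2 * v) t

theorem digitsVal_nil (t : ℤ) : digitsVal [] t = t := rfl

theorem digitsVal_cons (d : SignType) (l : List SignType) (t : ℤ) :
    digitsVal (d :: l) t = d + 2 * digitsVal l t := rfl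

/-- Missing digits can be read as the negative of the sign digit. -/
theorem digitsVal_eq_head_tail (l : List SignType) (t : SignType) :
    digitsVal l t = ((l.head?.getD (-t) : SignType) : ℤ) + 2 * digitsVal l.tail t := by
  cases l with
  | nil =>
    simp only [List.head?_nil, Option.getD_none, List.tail_nil, digitsVal_nil]
    cases t <;> rfl
  | cons d l => rfl

theorem digitsVal_sub_mem (l : List SignType) (hl : ∀ d ∈ l, d = 0 ∨ d = 1) (t : ℤ) :
    2 ^ l.length * t ≤ digitsVal l t ∧ digitsVal l t < 2 ^ l.length * (t + 1) := by
  induction l with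
  | nil => simp [digitsVal_nil]
  | cons d l ih =>
    obtain ⟨h1, h2⟩ := ih fun e he => hl e (List.mem_cons_of_mem _ he)
    rw [digitsVal_cons, List.length_cons, pow_succ']
    have : (d : ℤ) = 0 ∨ (d : ℤ) = 1 := by
      rcases hl d List.mem_cons_self with rfl | rfl <;> simp
    rw [mul_assoc, mul_assoc]
    lia

/-- The sign digit of a small number is `0` or `-1`. -/
theorem sign_eq_of_digitsVal (l : List SignType) (hl : ∀ d ∈ l, d = 0 ∨ d = 1) (t : ℤ)
    (h : |digitsVal l t| < 2 ^ l.length) : ((SignType.sign t : SignType) : ℤ) = t := by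
  obtain ⟨h1, h2⟩ := digitsVal_sub_mem l hl t
  obtain ⟨h3, h4⟩ := abs_lt.1 h
  have hp : (0 : ℤ) < 2 ^ l.length := by positivity
  have h5 : t < 1 := by
    by_contra! h5
    nlinarith
  have h6 : -1 ≤ t := by
    by_contra! h6
    nlinarith
  obtain rfl | rfl : t = 0 ∨ t = -1 := by lia
  · simp
  · simp

/-! ### Linear forms -/

/-- A `2 × 2` table of signed binary digits. -/
abbrev Cell : Type := Fin 2 → Fin 2 → SignType

/-- The integer matrix of a table of digits. -/
def Cell.toInt (D : Cell) : Matrix (Fin 2) (Fin 2) ℤ := Matrix.of fun i j => (D i j : ℤ)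

/-- Indices of the linear forms whose signs are computed. -/
abbrev FormIndex : Type := SignType × SignType × Letter

/-- The matrix of a linear form: for `(s, u, x)` the matrix `s + u x⁻¹`. -/
def form (k : ℤ) (q : FormIndex) : Matrix (Fin 2) (Fin 2) ℤ :=
  (q.1 : ℤ) • (1 : Matrix (Fin 2) (Fin 2) ℤ) + (q.2.1 : ℤ) • ((letterVal k q.2.2)⁻¹).1

/-- The index of the identity form. -/
def idForm : FormIndex := (1, 0, (0, true))

theorem form_idForm (k : ℤ) : form k idForm = 1 := by simp [form, idForm]

/-- Left multiplication by the inverse of a letter, or by nothing. -/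
def opMat (k : ℤ) (X : Option Letter) : SL(2, ℤ) := X.elim 1 fun x => (letterVal k x)⁻¹

/-- The composition of a form with a left multiplication. -/
def coeff (k : ℤ) (q : FormIndex) (X : Option Letter) : Matrix (Fin 2) (Fin 2) ℤ :=
  form k q * (opMat k X).1

/-- A bound for all carries. -/
def carryBound (k : ℤ) : ℤ :=
  ∑ q : FormIndex, ∑ X : Option Letter, ∑ i : Fin 2, ∑ l : Fin 2, |coeff k q X i l|

theorem sum_coeff_le_carryBound (k : ℤ) (q : FormIndex) (X : Option Letter) (i : Fin 2) :
    ∑ l : Fin 2, |coeff k q X i l| ≤ carryBound k := by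
  have h0 : ∀ (q : FormIndex) (X : Option Letter), 0 ≤ ∑ i : Fin 2, ∑ l : Fin 2, |coeff k q X i l| :=
    fun q X => Finset.sum_nonneg fun i _ => Finset.sum_nonneg fun l _ => abs_nonneg _
  calc _ ≤ ∑ i : Fin 2, ∑ l : Fin 2, |coeff k q X i l| :=
        Finset.single_le_sum (f := fun i => ∑ l : Fin 2, |coeff k q X i l|)
          (fun i _ => Finset.sum_nonneg fun l _ => abs_nonneg _) (Finset.mem_univ i)
    _ ≤ ∑ X : Option Letter, ∑ i : Fin 2, ∑ l : Fin 2, |coeff k q X i l| :=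
        Finset.single_le_sum (f := fun X => ∑ i : Fin 2, ∑ l : Fin 2, |coeff k q X i l|)
          (fun X _ => h0 q X) (Finset.mem_univ X)
    _ ≤ _ := Finset.single_le_sum
          (f := fun q => ∑ X : Option Letter, ∑ i : Fin 2, ∑ l : Fin 2, |coeff k q X i l|)
          (fun q _ => Finset.sum_nonneg fun X _ => h0 q X) (Finset.mem_univ q)

theorem carryBound_nonneg (k : ℤ) : 0 ≤ carryBound k :=
  (Finset.sum_nonneg fun _ _ => abs_nonneg _).trans (sum_coeff_le_carryBound k idForm none 0)

theorem abs_coeff_mul_le (k : ℤ) (q : FormIndex) (X : Option Letter) (D : Cell) (i j : Fin 2) :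
    |(coeff k q X * D.toInt) i j| ≤ carryBound k := by
  refine le_trans ?_ (sum_coeff_le_carryBound k q X i)
  rw [Matrix.mul_apply]
  refine (Finset.abs_sum_le_sum_abs _ _).trans (Finset.sum_le_sum fun l _ => ?_)
  rw [abs_mul]
  have : |D.toInt l j| ≤ 1 := by
    simp only [Cell.toInt, Matrix.of_apply]
    cases D l j <;> simp
  nlinarith [abs_nonneg (coeff k q X i l)]

/-- The carries of all forms. -/
abbrev Carry (k : ℤ) : Type :=
  FormIndex → Fin 2 → Fin 2 → Set.Icc (-carryBound k) (carryBound k)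

/-- The carries at the start. -/
def zeroCarry (k : ℤ) : Carry k := fun _ _ _ =>
  ⟨0, neg_nonpos.2 (carryBound_nonneg k), carryBound_nonneg k⟩

theorem coe_zeroCarry (k : ℤ) (q : FormIndex) (i j : Fin 2) : (zeroCarry k q i j : ℤ) = 0 := rfl

/-- The value of a form at a table of digits, plus its carry. -/
def total (k : ℤ) (X : Option Letter) (D : Cell) (c : Carry k) (q : FormIndex) (i j : Fin 2) : ℤ :=
  (coeff k q X * D.toInt) i j + c q i j

/-- The carries after the digits `D`. -/
noncomputable def nextCarry (k : ℤ) (X : Option Letter) (D : Cell) (c : Carry k) :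
    Carry k := fun q i j =>
  Set.projIcc (-carryBound k) (carryBound k)
    ((neg_nonpos.2 (carryBound_nonneg k)).trans (carryBound_nonneg k)) (total k X D c q i j / 2)

theorem coe_nextCarry (k : ℤ) (X : Option Letter) (D : Cell) (c : Carry k) (q : FormIndex)
    (i j : Fin 2) : (nextCarry k X D c q i j : ℤ) = total k X D c q i j / 2 := by
  have h1 := abs_le.1 (abs_coeff_mul_le k q X D i j)
  have h2 := (c q i j).2
  rw [Set.mem_Icc] at h2
  rw [nextCarry, Set.projIcc_of_mem _ (Set.mem_Icc.2 _)]
  unfold total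
  constructor <;> lia

/-- The digits of the product that are written for the digits `D`. -/
def outDigits (k : ℤ) (X : Option Letter) (D : Cell) (c : Carry k) : Cell := fun i j =>
  if total k X D c idForm i j % 2 = 0 then 0 else 1

theorem outDigits_eq (k : ℤ) (X : Option Letter) (D : Cell) (c : Carry k) (i j : Fin 2) :
    ((outDigits k X D c i j : SignType) : ℤ) = total k X D c idForm i j % 2 := by
  unfold outDigits
  split_ifs with h
  · simp [h]
  · simp; lia

/-! ### A sweep over the digits -/

/-- The lists of digits of the four entries. -/
abbrev Digits : Type := Fin 2 → Fin 2 → List SignType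

/-- The first digits. -/
def Digits.heads (E : Digits) (t : Cell) : Cell := fun i j => (E i j).head?.getD (-t i j)

/-- The other digits. -/
def Digits.tails (E : Digits) : Digits := fun i j => (E i j).tail

/-- The matrix with the digits `E` and the sign digits `t`. -/
def Digits.toMatrix (E : Digits) (t : Cell) : Matrix (Fin 2) (Fin 2) ℤ :=
  Matrix.of fun i j => digitsVal (E i j) (t i j)

theorem Digits.toMatrix_eq (E : Digits) (t : Cell) :
    E.toMatrix t = (E.heads t).toInt + (2 : ℤ) • E.tails.toMatrix t := by
  ext i j
  simpa [Digits.toMatrix, Cell.toInt, Digits.heads, Digits.tails] using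
    digitsVal_eq_head_tail (E i j) (t i j)

/-- The final carries and the digits written in a sweep over `n` digits. -/
noncomputable def sweep (k : ℤ) (X : Option Letter) (t : Cell) :
    ℕ → Digits → Carry k → Carry k × List Cell
  | 0, _, c => (c, [])
  | n + 1, E, c =>
    let r := sweep k X t n E.tails (nextCarry k X (E.heads t) c)
    (r.1, outDigits k X (E.heads t) c :: r.2)

theorem length_sweep (k : ℤ) (X : Option Letter) (t : Cell) (n : ℕ) (E : Digits) (c : Carry k) :
    (sweep k X t n E c).2.length = n := by
  induction n generalizing E c with
  | zero => rfl
  | succ n ih => simp [sweep, ih]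

theorem digit_of_mem_sweep (k : ℤ) (X : Option Letter) (t : Cell) (n : ℕ) (E : Digits)
    (c : Carry k) (i j : Fin 2) :
    ∀ d ∈ (sweep k X t n E c).2.map (fun D => D i j), d = 0 ∨ d = 1 := by
  induction n generalizing E c with
  | zero => simp [sweep]
  | succ n ih =>
    simp only [sweep, List.map_cons, List.mem_cons, forall_eq_or_imp]
    refine ⟨?_, ih _ _⟩
    unfold outDigits
    split_ifs <;> simp

theorem total_add_eq (k : ℤ) (X : Option Letter) (t : Cell) (E : Digits) (c : Carry k)
    (q : FormIndex) (i j : Fin 2) : (coeff k q X * E.toMatrix t) i j + c q i j =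
      total k X (E.heads t) c q i j + 2 * (coeff k q X * E.tails.toMatrix t) i j := by
  rw [Digits.toMatrix_eq, mul_add, Matrix.add_apply, Matrix.mul_smul, Matrix.smul_apply, total,
    smul_eq_mul]
  ring

theorem toMatrix_of_length_le_zero {E : Digits} (h : ∀ i j, (E i j).length ≤ 0) (t : Cell) :
    E.toMatrix t = t.toInt := by
  ext i j
  simp [Digits.toMatrix, List.eq_nil_of_length_eq_zero (Nat.le_zero.1 (h i j)), digitsVal_nil,
    Cell.toInt]

theorem length_tails_le {E : Digits} {n : ℕ} (h : ∀ i j, (E i j).length ≤ n + 1) (i j : Fin 2) :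
    (E.tails i j).length ≤ n := by
  simpa [Digits.tails] using h i j

theorem nonneg_iff_sweep (k : ℤ) (X : Option Letter) (t : Cell) (n : ℕ) (E : Digits)
    (hE : ∀ i j, (E i j).length ≤ n) (c : Carry k) (q : FormIndex) (i j : Fin 2) :
    0 ≤ total k X t (sweep k X t n E c).1 q i j ↔
      0 ≤ (coeff k q X * E.toMatrix t) i j + c q i j := by
  induction n generalizing E c with
  | zero => rw [toMatrix_of_length_le_zero hE]; rfl
  | succ n ih =>
    rw [total_add_eq, sweep, ih _ (length_tails_le hE), coe_nextCarry]
    lia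

theorem digitsVal_sweep (k : ℤ) (X : Option Letter) (t : Cell) (n : ℕ) (E : Digits)
    (hE : ∀ i j, (E i j).length ≤ n) (c : Carry k) (i j : Fin 2) :
    digitsVal ((sweep k X t n E c).2.map fun D => D i j)
      (total k X t (sweep k X t n E c).1 idForm i j) =
      (coeff k idForm X * E.toMatrix t) i j + c idForm i j := by
  induction n generalizing E c with
  | zero => rw [toMatrix_of_length_le_zero hE]; rfl
  | succ n ih =>
    rw [total_add_eq, sweep, List.map_cons, digitsVal_cons, ih _ (length_tails_le hE),
      coe_nextCarry, outDigits_eq]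
    lia

/-- The sign digits after a sweep. -/
noncomputable def topDigits (k : ℤ) (X : Option Letter) (t : Cell) (c : Carry k) : Cell := fun i j =>
  SignType.sign (total k X t c idForm i j)

theorem toMatrix_sweep {k : ℤ} {X : Option Letter} {t : Cell} {n : ℕ} {E : Digits}
    (hE : ∀ i j, (E i j).length ≤ n) {N : SL(2, ℤ)} (hN : N.1 = (opMat k X).1 * E.toMatrix t)
    (hsmall : ∀ i j, |N.1 i j| < 2 ^ n) :
    Digits.toMatrix (fun i j => (sweep k X t n E (zeroCarry k)).2.map fun D => D i j)
      (topDigits k X t (sweep k X t n E (zeroCarry k)).1) = N.1 := by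
  ext i j
  have h := digitsVal_sweep k X t n E hE (zeroCarry k) i j
  rw [coeff, form_idForm, one_mul, ← hN, coe_zeroCarry, add_zero] at h
  rw [Digits.toMatrix, Matrix.of_apply, topDigits, sign_eq_of_digitsVal _
    (digit_of_mem_sweep k X t n E (zeroCarry k) i j) _
    (by rw [h, List.length_map, length_sweep]; exact hsmall i j)]
  exact h

/-! ### The decision after a sweep -/

/-- The sign test for `|n'| ≤ |n|`, where `n` is an entry of a matrix and `n'` is the entry after
the letter `x` has been removed. -/
def leTest (f : FormIndex → Fin 2 → Fin 2 → Prop) (x : Letter) (i j : Fin 2) : Prop :=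
  (f (1, 1, x) i j ∧ f (1, -1, x) i j) ∨ (f (-1, 1, x) i j ∧ f (-1, -1, x) i j)

/-- The sign test for `|n| ≤ |n'|`, where `n` is an entry of a matrix and `n'` is the entry after
the letter `x` has been removed. -/
def geTest (f : FormIndex → Fin 2 → Fin 2 → Prop) (x : Letter) (i j : Fin 2) : Prop :=
  (f (-1, 1, x) i j ∧ f (1, 1, x) i j) ∨ (f (1, -1, x) i j ∧ f (-1, -1, x) i j)

/-- The sign test for an entrywise reduction. -/
def shrinkTest (f : FormIndex → Fin 2 → Fin 2 → Prop) (x : Letter) : Prop :=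
  (∀ i j, leTest f x i j) ∧ ∃ i j, ¬ geTest f x i j

/-- The sign test for the identity matrix. -/
def oneTest (f : FormIndex → Fin 2 → Fin 2 → Prop) : Prop :=
  f idForm 0 0 ∧ (∀ i, f idForm i (i + 1)) ∧ ∀ i, f (-1, 0, (0, true)) i (i + 1)

open Classical in
/-- The next letter to be removed, or the final answer. -/
noncomputable def decision (f : FormIndex → Fin 2 → Fin 2 → Prop) : Letter ⊕ Bool :=
  if h : ∃ x, shrinkTest f x then .inl h.choose else .inr (decide (oneTest f))

/-- The nonnegative forms of a matrix. -/
def nonnegForms (k : ℤ) (N : SL(2, ℤ)) (q : FormIndex) (i j : Fin 2) : Prop :=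
  0 ≤ (form k q * N.1) i j

theorem form_mul_apply (k : ℤ) (q : FormIndex) (N : SL(2, ℤ)) (i j : Fin 2) :
    (form k q * N.1) i j = q.1 * N.1 i j + q.2.1 * ((letterVal k q.2.2)⁻¹ * N).1 i j := by
  rw [form, add_mul, Matrix.smul_mul, Matrix.smul_mul, one_mul]
  rfl

theorem leTest_nonnegForms {k : ℤ} {N : SL(2, ℤ)} {x : Letter} {i j : Fin 2} :
    leTest (nonnegForms k N) x i j ↔ |((letterVal k x)⁻¹ * N).1 i j| ≤ |N.1 i j| := by
  simp only [leTest, nonnegForms, form_mul_apply, SignType.coe_one, SignType.coe_neg_one]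
  generalize N.1 i j = a, ((letterVal k x)⁻¹ * N).1 i j = b
  rcases abs_cases a with ⟨h, _⟩ | ⟨h, _⟩ <;> rcases abs_cases b with ⟨h', _⟩ | ⟨h', _⟩ <;>
    rw [h, h'] <;> lia

theorem geTest_nonnegForms {k : ℤ} {N : SL(2, ℤ)} {x : Letter} {i j : Fin 2} :
    geTest (nonnegForms k N) x i j ↔ |N.1 i j| ≤ |((letterVal k x)⁻¹ * N).1 i j| := by
  simp only [geTest, nonnegForms, form_mul_apply, SignType.coe_one, SignType.coe_neg_one]
  generalize N.1 i j = a, ((letterVal k x)⁻¹ * N).1 i j = b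
  rcases abs_cases a with ⟨h, _⟩ | ⟨h, _⟩ <;> rcases abs_cases b with ⟨h', _⟩ | ⟨h', _⟩ <;>
    rw [h, h'] <;> lia

theorem shrinkTest_nonnegForms {k : ℤ} {N : SL(2, ℤ)} {x : Letter} :
    shrinkTest (nonnegForms k N) x ↔ Shrinks ((letterVal k x)⁻¹ * N).1 N.1 := by
  simp only [shrinkTest, leTest_nonnegForms, geTest_nonnegForms, not_le, Shrinks]

theorem oneTest_nonnegForms {k : ℤ} {N : SL(2, ℤ)} : oneTest (nonnegForms k N) ↔ N = 1 := by
  simp only [oneTest, nonnegForms, idForm, form_mul_apply, SignType.coe_one, SignType.coe_neg_one,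
    SignType.coe_zero, zero_mul, add_zero, one_mul, Fin.forall_fin_two, zero_add, Fin.reduceAdd]
  constructor
  · rintro ⟨h0, ⟨h1, h2⟩, h3, h4⟩
    have hb : N.1 0 1 = 0 := by lia
    have hc : N.1 1 0 = 0 := by lia
    have hdet : N.1 0 0 * N.1 1 1 - N.1 0 1 * N.1 1 0 = 1 := by
      rw [← Matrix.det_fin_two]; exact N.2
    rw [hb, zero_mul, sub_zero] at hdet
    have ha : N.1 0 0 = 1 := Int.eq_one_of_mul_eq_one_right h0 hdet
    rw [ha, one_mul] at hdet
    apply ext_entries <;> intro j <;> fin_cases j <;> simp [ha, hb, hc, hdet]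
  · rintro rfl
    simp

theorem decision_eq_inl {k : ℤ} {N : SL(2, ℤ)} {x : Letter}
    (h : decision (nonnegForms k N) = .inl x) : Shrinks ((letterVal k x)⁻¹ * N).1 N.1 := by
  unfold decision at h
  split_ifs at h with h'
  rw [← Sum.inl.inj h]
  exact shrinkTest_nonnegForms.1 h'.choose_spec

theorem decision_eq_inr {k : ℤ} (hk : 2 ≤ k) {N : SL(2, ℤ)} {b : Bool}
    (h : decision (nonnegForms k N) = .inr b) : GreedyRun k N (if b then some [] else none) := by
  classical
  unfold decision at h
  split_ifs at h with h'
  simp only [Sum.inr.injEq] at h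
  subst h
  by_cases h1 : N = 1
  · rw [decide_eq_true (oneTest_nonnegForms.2 h1), h1]
    exact .one
  · rw [decide_eq_false (oneTest_nonnegForms.not.2 h1)]
    refine greedyRun_none hk fun hmem => h' ?_
    obtain ⟨x, hx⟩ := exists_shrinks hk hmem h1
    exact ⟨x, shrinkTest_nonnegForms.2 hx⟩

/-- The forms that turn out to be nonnegative at the end of a sweep. -/
def sweepForms (k : ℤ) (X : Option Letter) (t : Cell) (c : Carry k) (q : FormIndex) (i j : Fin 2) :
    Prop := 0 ≤ total k X t c q i j

theorem sweepForms_eq {k : ℤ} {X : Option Letter} {t : Cell} {n : ℕ} {E : Digits}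
    (hE : ∀ i j, (E i j).length ≤ n) {N : SL(2, ℤ)} (hN : N.1 = (opMat k X).1 * E.toMatrix t) :
    sweepForms k X t (sweep k X t n E (zeroCarry k)).1 = nonnegForms k N := by
  funext q i j
  rw [sweepForms, nonneg_iff_sweep k X t n E hE, coeff, Matrix.mul_assoc, ← hN, coe_zeroCarry, add_zero]
  rfl

/-! ### The machine -/

open Turing Computability

/-- The stacks: the input, the digits of the four entries, an auxiliary stack for the digits
written in a sweep, the letters removed so far, and the output. -/
inductive StackIndex
  | inp
  | ent (i j : Fin 2)
  | aux
  | word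
  | out
  deriving DecidableEq, Fintype

/-- The finite alphabets of the stacks. -/
abbrev StackIndex.Alphabet : StackIndex → Type
  | .inp => Γ'
  | .ent _ _ => SignType
  | .aux => Cell
  | .word => Letter
  | .out => Bool ⊕ Letter

instance : ∀ q : StackIndex, Fintype q.Alphabet
  | .inp => inferInstanceAs (Fintype Γ')
  | .ent _ _ => inferInstanceAs (Fintype SignType)
  | .aux => inferInstanceAs (Fintype Cell)
  | .word => inferInstanceAs (Fintype Letter)
  | .out => inferInstanceAs (Fintype (Bool ⊕ Letter))

/-- The labels of the machine; the elements of `κ` are the possible carries. -/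
inductive Label (κ : Type)
  /-- read the sign of an entry -/
  | readSign (i j : Fin 2)
  /-- read the digits of an entry -/
  | readDigits (i j : Fin 2) (neg : Bool)
  /-- multiply the matrix by a letter, and compute the signs of the forms -/
  | forward (X : Option Letter) (t : Cell) (c : κ)
  /-- return to the least significant digits -/
  | backward (t : Cell) (x : Letter)
  /-- erase the auxiliary stack -/
  | erase (b : Bool)
  /-- write the output -/
  | write (b : Bool)

/-- The registers: the symbols read last. -/
structure Register where
  heads : Fin 2 → Fin 2 → Option SignType
  sym : Option Γ'
  cell : Option Cell
  letter : Option Letter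

/-- Empty registers. -/
def Register.empty : Register := ⟨fun _ _ => none, none, none, none⟩

noncomputable instance : Fintype Register :=
  Fintype.ofInjective
    (fun s : Register => (s.heads, s.sym, s.cell, s.letter)) fun s s' h => by
      cases s; cases s'; simp_all

noncomputable instance (κ : Type) [Fintype κ] : Fintype (Label κ) := by
  classical
  refine Fintype.ofInjective (β := (Fin 2 × Fin 2) ⊕ (Fin 2 × Fin 2 × Bool) ⊕
    (Option Letter × Cell × κ) ⊕ (Cell × Letter) ⊕ Bool ⊕ Bool)
    (fun
      | .readSign i j => .inl (i, j)
      | .readDigits i j b => .inr (.inl (i, j, b))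
      | .forward X t c => .inr (.inr (.inl (X, t, c)))
      | .backward t x => .inr (.inr (.inr (.inl (t, x))))
      | .erase b => .inr (.inr (.inr (.inr (.inl b))))
      | .write b => .inr (.inr (.inr (.inr (.inr b))))) fun l l' h => ?_
  cases l <;> cases l' <;> simp_all

/-- Statements of the machine. -/
abbrev Stmt (k : ℤ) : Type := TM2.Stmt StackIndex.Alphabet (Label (Carry k)) Register

/-- Pop one digit of the entry `i, j`. -/
def popDigit {k : ℤ} (i j : Fin 2) : Stmt k → Stmt k :=
  .pop (.ent i j) fun s o =>
    { s with heads := Function.update s.heads i (Function.update (s.heads i) j o) }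

/-- Pop one digit of each entry. -/
def popDigits {k : ℤ} (q : Stmt k) : Stmt k :=
  popDigit 0 0 (popDigit 0 1 (popDigit 1 0 (popDigit 1 1 q)))

/-- Push one digit of each entry. -/
def pushDigits {k : ℤ} (f : Register → Cell) (q : Stmt k) : Stmt k :=
  .push (.ent 0 0) (fun s => f s 0 0) (.push (.ent 0 1) (fun s => f s 0 1)
    (.push (.ent 1 0) (fun s => f s 1 0) (.push (.ent 1 1) (fun s => f s 1 1) q)))

/-- The digit of a bit of a negative or nonnegative number. -/
def signedBit (neg b : Bool) : SignType := if b then (if neg then -1 else 1) else 0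

/-- The bit of an input symbol. -/
def bitOf : Option Γ' → Option Bool
  | some (.bit b) => some b
  | _ => none

/-- The label after the digits of the entry `i, j` have been read. -/
def afterDigits (k : ℤ) : Fin 2 → Fin 2 → Label (Carry k)
  | 0, 0 => .readSign 0 1
  | 0, 1 => .readSign 1 0
  | 1, 0 => .readSign 1 1
  | 1, 1 => .forward none (fun _ _ => 0) (zeroCarry k)

/-- The label after a sweep. -/
noncomputable def afterForward (k : ℤ) (X : Option Letter) (t : Cell) (c : Carry k) : Label (Carry k) :=
  match decision (sweepForms k X t c) with
  | .inl x => .backward (topDigits k X t c) x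
  | .inr b => .erase b

/-- The digits in the registers. -/
def Register.digits (s : Register) (t : Cell) : Cell := fun i j => (s.heads i j).getD (-t i j)

/-- The program of the machine. -/
noncomputable def program (k : ℤ) : Label (Carry k) → Stmt k
  | .readSign i j =>
    .pop .inp (fun s o => { s with sym := o }) <|
    .goto fun s => .readDigits i j ((bitOf s.sym).getD false)
  | .readDigits i j neg =>
    .pop .inp (fun s o => { s with sym := o }) <|
    .branch (fun s => (bitOf s.sym).isSome)
      (.push (.ent i j) (fun s => signedBit neg ((bitOf s.sym).getD false)) <|
        .goto fun _ => .readDigits i j neg)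
      (.goto fun _ => afterDigits k i j)
  | .forward X t c =>
    popDigits <|
    .branch (fun s => decide (∀ i j, s.heads i j = none))
      (.goto fun _ => afterForward k X t c)
      (.push .aux (fun s => outDigits k X (s.digits t) c) <|
        .goto fun s => .forward X t (nextCarry k X (s.digits t) c))
  | .backward t x =>
    .pop .aux (fun s o => { s with cell := o }) <|
    .branch (fun s => s.cell.isSome)
      (pushDigits (fun s => s.cell.getD 0) <| .goto fun _ => .backward t x)
      (.push .word (fun _ => x) <| .goto fun _ => .forward (some x) t (zeroCarry k))
  | .erase b =>
    .pop .aux (fun s o => { s with cell := o }) <|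
    .branch (fun s => s.cell.isSome) (.goto fun _ => .erase b) (.goto fun _ => .write b)
  | .write b =>
    .pop .word (fun s o => { s with letter := o }) <|
    .branch (fun s => s.letter.isSome)
      (.branch (fun _ => b)
        (.push .out (fun s => .inr (s.letter.getD (0, true))) <| .goto fun _ => .write b)
        (.goto fun _ => .write b))
      (.push .out (fun _ => .inl b) <| .load (fun _ => .empty) .halt)

/-- The machine for the membership search problem. -/
noncomputable def machine (k : ℤ) : TM2ComputableAux Γ' (Bool ⊕ Letter) where
  tm :=
    { K := StackIndex
      k₀ := .inp
      k₁ := .out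
      Γ := StackIndex.Alphabet
      Λ := Label (Carry k)
      main := .readSign 0 0
      σ := Register
      initialState := .empty
      Γk₀Fin := inferInstanceAs (Fintype (StackIndex.Alphabet .inp))
      m := program k }
  inputAlphabet := Equiv.refl _
  outputAlphabet := Equiv.refl _

/-! ### Contents of the stacks -/

/-- The contents of all stacks. -/
def stackList (inp : List Γ') (E : Digits) (aux : List Cell) (word : List Letter)
    (out : List (Bool ⊕ Letter)) : ∀ q : StackIndex, List q.Alphabet
  | .inp => inp
  | .ent i j => E i j
  | .aux => aux
  | .word => word
  | .out => out

section

variable (inp : List Γ') (E : Digits) (aux : List Cell) (word : List Letter)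
  (out : List (Bool ⊕ Letter))

theorem update_inp (l : List Γ') : Function.update (stackList inp E aux word out) .inp l =
    stackList l E aux word out := by
  funext q; cases q <;> simp [Function.update, stackList]

theorem update_ent (i j : Fin 2) (l : List SignType) :
    Function.update (stackList inp E aux word out) (.ent i j) l =
      stackList inp (Function.update E i (Function.update (E i) j l)) aux word out := by
  funext q
  rcases q with _ | ⟨i', j'⟩ | _ | _ | _
  · rfl
  · by_cases hi : i' = i
    · subst hi
      by_cases hj : j' = j
      · subst hj; simp [stackList]
      · simp [stackList, hj]
    · simp [stackList, hi]
  all_goals rfl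

theorem update_aux (l : List Cell) : Function.update (stackList inp E aux word out) .aux l =
    stackList inp E l word out := by
  funext q; cases q <;> simp [Function.update, stackList]

theorem update_word (l : List Letter) : Function.update (stackList inp E aux word out) .word l =
    stackList inp E aux l out := by
  funext q; cases q <;> simp [Function.update, stackList]

theorem update_out (l : List (Bool ⊕ Letter)) :
    Function.update (stackList inp E aux word out) .out l = stackList inp E aux word l := by
  funext q; cases q <;> simp [Function.update, stackList]

theorem stepAux_popDigits {k : ℤ} (q : Stmt k) (s : Register) :
    TM2.stepAux (popDigits q) s (stackList inp E aux word out) =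
      TM2.stepAux q { s with heads := fun i j => (E i j).head? }
        (stackList inp E.tails aux word out) := by
  simp only [popDigits, popDigit, TM2.stepAux, update_ent]
  congr 2
  · funext i j; fin_cases i <;> fin_cases j <;> rfl
  · funext i j; fin_cases i <;> fin_cases j <;> rfl

theorem stepAux_pushDigits {k : ℤ} (f : Register → Cell) (q : Stmt k) (s : Register) :
    TM2.stepAux (pushDigits f q) s (stackList inp E aux word out) =
      TM2.stepAux q s (stackList inp (fun i j => f s i j :: E i j) aux word out) := by
  simp only [pushDigits, TM2.stepAux, update_ent]
  congr 2
  funext i j; fin_cases i <;> fin_cases j <;> rfl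

end

/-! ### Runs of the machine -/

/-- From the label and the stacks `a`, whatever the registers are, the machine arrives at the label
and the stacks `b` after at most `n` steps. -/
def ReachesIn (k : ℤ) (n : ℕ) (a b : Label (Carry k) × ∀ q : StackIndex, List q.Alphabet) : Prop :=
  ∀ s, ∃ m ≤ n, ∃ s', (flip bind (TM2.step (program k)))^[m] (some ⟨some a.1, s, a.2⟩) =
    some ⟨some b.1, s', b.2⟩

theorem ReachesIn.refl {k : ℤ} (a : Label (Carry k) × ∀ q : StackIndex, List q.Alphabet) :
    ReachesIn k 0 a a := fun s => ⟨0, le_rfl, s, rfl⟩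

theorem ReachesIn.trans {k : ℤ} {m n : ℕ}
    {a b c : Label (Carry k) × ∀ q : StackIndex, List q.Alphabet}
    (h : ReachesIn k m a b) (h' : ReachesIn k n b c) : ReachesIn k (m + n) a c := by
  intro s
  obtain ⟨i, hi, s', hs'⟩ := h s
  obtain ⟨j, hj, s'', hs''⟩ := h' s'
  exact ⟨j + i, by lia, s'', by rw [Function.iterate_add_apply, hs', hs'']⟩

theorem ReachesIn.mono {k : ℤ} {m n : ℕ} {a b : Label (Carry k) × ∀ q : StackIndex, List q.Alphabet}
    (h : ReachesIn k m a b) (hmn : m ≤ n) : ReachesIn k n a b := fun s =>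
  let ⟨i, hi, hs⟩ := h s
  ⟨i, hi.trans hmn, hs⟩

theorem ReachesIn.step {k : ℤ} {l l' : Label (Carry k)} {S S' : ∀ q : StackIndex, List q.Alphabet}
    (h : ∀ s, ∃ s', TM2.stepAux (program k l) s S = ⟨some l', s', S'⟩) :
    ReachesIn k 1 (l, S) (l', S') := by
  intro s
  obtain ⟨s', hs'⟩ := h s
  exact ⟨1, le_rfl, s', congrArg some hs'⟩

section

variable {k : ℤ} (E : Digits) (aux : List Cell) (word : List Letter) (out : List (Bool ⊕ Letter))

theorem step_readSign (i j : Fin 2) (b : Bool) (inp : List Γ') :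
    ReachesIn k 1 (.readSign i j, stackList (.bit b :: inp) E aux word out)
      (.readDigits i j b, stackList inp E aux word out) :=
  .step fun s => ⟨{ s with sym := some (.bit b) }, by
    simp only [program, TM2.stepAux, update_inp]; rfl⟩

theorem step_readDigits_bit (i j : Fin 2) (neg b : Bool) (inp : List Γ') :
    ReachesIn k 1 (.readDigits i j neg, stackList (.bit b :: inp) E aux word out)
      (.readDigits i j neg, stackList inp
        (Function.update E i (Function.update (E i) j (signedBit neg b :: E i j))) aux word out) :=
  .step fun s => ⟨{ s with sym := some (.bit b) }, by
    simp only [program, TM2.stepAux, update_inp, update_ent]; rfl⟩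

theorem step_readDigits_comma (i j : Fin 2) (neg : Bool) (inp : List Γ') :
    ReachesIn k 1 (.readDigits i j neg, stackList (.comma :: inp) E aux word out)
      (afterDigits k i j, stackList inp E aux word out) :=
  .step fun s => ⟨{ s with sym := some .comma }, by
    simp only [program, TM2.stepAux, update_inp]; rfl⟩

theorem step_forward (X : Option Letter) (t : Cell) (c : Carry k) (inp : List Γ')
    (hE : ∃ i j, E i j ≠ []) :
    ReachesIn k 1 (.forward X t c, stackList inp E aux word out)
      (.forward X t (nextCarry k X (E.heads t) c),
        stackList inp E.tails (outDigits k X (E.heads t) c :: aux) word out) :=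
  .step fun s => ⟨{ s with heads := fun i j => (E i j).head? }, by
    have : ¬ ∀ i j, (E i j).head? = none := by
      obtain ⟨i, j, h⟩ := hE
      exact fun h' => h (List.head?_eq_none_iff.1 (h' i j))
    simp only [program, stepAux_popDigits, TM2.stepAux, update_aux, decide_eq_false this]
    rfl⟩

theorem step_forward_nil (X : Option Letter) (t : Cell) (c : Carry k) (inp : List Γ') :
    ReachesIn k 1 (.forward X t c, stackList inp (fun _ _ => []) aux word out)
      (afterForward k X t c, stackList inp (fun _ _ => []) aux word out) :=
  .step fun s => ⟨{ s with heads := fun i j => none }, by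
    simp only [program, stepAux_popDigits, TM2.stepAux]; rfl⟩

theorem step_backward (t : Cell) (x : Letter) (D : Cell) (inp : List Γ') :
    ReachesIn k 1 (.backward t x, stackList inp E (D :: aux) word out)
      (.backward t x, stackList inp (fun i j => D i j :: E i j) aux word out) :=
  .step fun s => ⟨{ s with cell := some D }, by
    simp only [program, TM2.stepAux, update_aux]
    exact stepAux_pushDigits inp E aux word out (fun s => s.cell.getD 0)
      (.goto fun _ => .backward t x) { s with cell := some D }⟩

theorem step_backward_nil (t : Cell) (x : Letter) (inp : List Γ') :
    ReachesIn k 1 (.backward t x, stackList inp E [] word out)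
      (.forward (some x) t (zeroCarry k), stackList inp E [] (x :: word) out) :=
  .step fun s => ⟨{ s with cell := none }, by
    simp only [program, TM2.stepAux, update_aux, update_word]; rfl⟩

theorem step_erase (b : Bool) (D : Cell) (inp : List Γ') :
    ReachesIn k 1 (.erase b, stackList inp E (D :: aux) word out)
      (.erase b, stackList inp E aux word out) :=
  .step fun s => ⟨{ s with cell := some D }, by
    simp only [program, TM2.stepAux, update_aux]; rfl⟩

theorem step_erase_nil (b : Bool) (inp : List Γ') :
    ReachesIn k 1 (.erase b, stackList inp E [] word out) (.write b, stackList inp E [] word out) :=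
  .step fun s => ⟨{ s with cell := none }, by
    simp only [program, TM2.stepAux, update_aux]; rfl⟩

theorem step_write (b : Bool) (x : Letter) (inp : List Γ') :
    ReachesIn k 1 (.write b, stackList inp E aux (x :: word) out)
      (.write b, stackList inp E aux word (if b then .inr x :: out else out)) :=
  .step fun s => ⟨{ s with letter := some x }, by
    cases b <;> simp only [program, TM2.stepAux, update_word, update_out] <;> rfl⟩

theorem stepAux_write_nil (b : Bool) (inp : List Γ') (s : Register) :
    TM2.stepAux (program k (.write b)) s (stackList inp E aux [] out) =
      ⟨none, .empty, stackList inp E aux [] (.inl b :: out)⟩ := by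
  simp only [program, TM2.stepAux, update_word, update_out]; rfl

end

/-! ### Reading the input -/

/-- The signed binary digits of an integer. -/
def intDigits (z : ℤ) : List SignType := (Nat.bits z.natAbs).map (signedBit (decide (z < 0)))

theorem digitsVal_map_signedBit (neg : Bool) (n : ℕ) :
    digitsVal ((Nat.bits n).map (signedBit neg)) 0 = if neg then -(n : ℤ) else n := by
  induction n using Nat.binaryRec' with
  | zero => simp [digitsVal_nil]
  | bit b n h ih =>
    rw [Nat.bits_append_bit n b h, List.map_cons, digitsVal_cons, ih, Nat.bit_val]
    cases b <;> cases neg <;> simp [signedBit]; ring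

theorem digitsVal_intDigits (z : ℤ) : digitsVal (intDigits z) 0 = z := by
  rw [intDigits, digitsVal_map_signedBit]
  split_ifs with h <;> simp only [decide_eq_true_eq] at h <;> lia

theorem length_intDigits (z : ℤ) : (intDigits z).length = z.natAbs.size := by
  rw [intDigits, List.length_map, Nat.size_eq_bits_len]

section

variable {k : ℤ} (aux : List Cell) (word : List Letter) (out : List (Bool ⊕ Letter))

theorem run_readDigits (i j : Fin 2) (neg : Bool) (l : List Bool) (inp : List Γ') (E : Digits) :
    ReachesIn k (l.length + 1)
      (.readDigits i j neg, stackList (l.map Γ'.bit ++ .comma :: inp) E aux word out)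
      (afterDigits k i j, stackList inp (Function.update E i (Function.update (E i) j
        ((l.map (signedBit neg)).reverse ++ E i j))) aux word out) := by
  induction l generalizing E with
  | nil => simpa using step_readDigits_comma E aux word out i j neg inp
  | cons b l ih =>
    have h := (step_readDigits_bit E aux word out i j neg b (l.map Γ'.bit ++ .comma :: inp)).trans
      (ih _)
    simp only [Function.update_self, Function.update_idem] at h
    simpa [add_comm 1] using h

theorem run_readEntry (i j : Fin 2) (z : ℤ) (inp : List Γ') (E : Digits) (hE : E i j = []) :
    ReachesIn k (z.natAbs.size + 2)
      (.readSign i j, stackList (encodeInt z ++ .comma :: inp) E aux word out)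
      (afterDigits k i j, stackList inp
        (Function.update E i (Function.update (E i) j (intDigits z))) aux word out) := by
  have h := (step_readSign E aux word out i j (decide (z < 0))
    ((Nat.bits z.natAbs).reverse.map Γ'.bit ++ .comma :: inp)).trans
    (run_readDigits (k := k) aux word out i j _ _ _ _)
  have hd : ((Nat.bits z.natAbs).reverse.map (signedBit (decide (z < 0)))).reverse =
      intDigits z := by
    rw [List.map_reverse, List.reverse_reverse, intDigits]
  rw [hE, List.append_nil, hd, List.length_reverse] at h
  exact h.mono (by rw [Nat.size_eq_bits_len]; lia)

theorem run_read (M : SL(2, ℤ)) (n : ℕ) (hn : ∀ i j, (M.1 i j).natAbs.size ≤ n) :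
    ReachesIn k (4 * n + 8)
      (.readSign 0 0, stackList (encodeMatrix M) (fun _ _ => []) aux word out)
      (.forward none (fun _ _ => 0) (zeroCarry k),
        stackList [] (fun i j => intDigits (M.1 i j)) aux word out) := by
  have h := (((run_readEntry (k := k) aux word out 0 0 (M.1 0 0) _ (fun _ _ => []) rfl).trans
    (run_readEntry aux word out 0 1 (M.1 0 1) _ _ rfl)).trans
    (run_readEntry aux word out 1 0 (M.1 1 0) _ _ rfl)).trans
    (run_readEntry aux word out 1 1 (M.1 1 1) [] _ rfl)
  have hE : (fun i j => intDigits (M.1 i j)) = Function.update (Function.update (Function.update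
      (Function.update (fun _ _ => [] : Digits) 0 (Function.update (fun _ => []) 0
        (intDigits (M.1 0 0)))) 0 (Function.update (Function.update (fun _ => []) 0
        (intDigits (M.1 0 0))) 1 (intDigits (M.1 0 1)))) 1 (Function.update (fun _ => []) 0
        (intDigits (M.1 1 0)))) 1 (Function.update (Function.update (fun _ => []) 0
        (intDigits (M.1 1 0))) 1 (intDigits (M.1 1 1))) := by
    funext i j
    fin_cases i <;> fin_cases j <;> rfl
  rw [hE]
  refine h.mono ?_
  have := hn 0 0
  have := hn 0 1
  have := hn 1 0
  have := hn 1 1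
  lia

/-! ### The main loop -/

theorem run_forward (X : Option Letter) (t : Cell) (n : ℕ) (E : Digits)
    (hE : ∀ i j, (E i j).length ≤ n) (hn : ∃ i j, (E i j).length = n) (c : Carry k)
    (inp : List Γ') :
    ReachesIn k (n + 1) (.forward X t c, stackList inp E aux word out)
      (afterForward k X t (sweep k X t n E c).1, stackList inp (fun _ _ => [])
        ((sweep k X t n E c).2.reverse ++ aux) word out) := by
  induction n generalizing E c aux with
  | zero =>
    obtain rfl : E = fun _ _ => [] := by
      funext i j
      exact List.eq_nil_of_length_eq_zero (Nat.le_zero.1 (hE i j))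
    exact step_forward_nil aux word out X t c inp
  | succ n ih =>
    obtain ⟨i, j, hij⟩ := hn
    have h := (step_forward E aux word out X t c inp
      ⟨i, j, List.ne_nil_of_length_eq_add_one hij⟩).trans
      (ih _ _ (length_tails_le hE) ⟨i, j, by simp [Digits.tails, hij]⟩ _)
    simpa [sweep, add_comm 1] using h

theorem run_backward (t : Cell) (x : Letter) (E : Digits) (inp : List Γ') :
    ReachesIn k (aux.length + 1) (.backward t x, stackList inp E aux word out)
      (.forward (some x) t (zeroCarry k),
        stackList inp (fun i j => aux.reverse.map (fun D => D i j) ++ E i j) [] (x :: word) out) := by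
  induction aux generalizing E with
  | nil => simpa using step_backward_nil E word out t x inp
  | cons D aux ih =>
    have h := (step_backward E aux word out t x D inp).trans (ih _)
    simpa [add_comm 1] using h

theorem run_erase (E : Digits) (b : Bool) (inp : List Γ') :
    ReachesIn k (aux.length + 1) (.erase b, stackList inp E aux word out)
      (.write b, stackList inp E [] word out) := by
  induction aux with
  | nil => exact step_erase_nil E word out b inp
  | cons D aux ih => simpa [add_comm 1] using (step_erase E aux word out b D inp).trans ih

theorem run_write (E : Digits) (b : Bool) (inp : List Γ') :
    ReachesIn k word.length (.write b, stackList inp E aux word out)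
      (.write b, stackList inp E aux [] (if b then word.reverse.map .inr ++ out else out)) := by
  induction word generalizing out with
  | nil => simpa using ReachesIn.refl _
  | cons x word ih =>
    have h := (step_write E aux word out b x inp).trans (ih _)
    cases b <;> simpa [add_comm 1] using h

end

theorem run_loop {k : ℤ} (hk : 2 ≤ k) (n : ℕ) (out : List (Bool ⊕ Letter)) (s : ℕ) (N : SL(2, ℤ))
    (hs : size N ≤ s) (X : Option Letter) (t : Cell) (E : Digits) (word : List Letter)
    (hE : ∀ i j, (E i j).length ≤ n) (hn : ∃ i j, (E i j).length = n)
    (hN : N.1 = (opMat k X).1 * E.toMatrix t) (hsmall : ∀ i j, |N.1 i j| < 2 ^ n) :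
    ∃ (b : Bool) (w : List Letter) (aux : List Cell),
      GreedyRun k N (if b then some w else none) ∧ w.length ≤ s ∧ aux.length = n ∧
      ReachesIn k ((s + 1) * (2 * n + 2)) (.forward X t (zeroCarry k), stackList [] E [] word out)
        (.erase b, stackList [] (fun _ _ => []) aux (w.reverse ++ word) out) := by
  induction s generalizing N X t E word with
  | zero =>
    have h := run_forward (k := k) [] word out X t n E hE hn (zeroCarry k) []
    rw [afterForward, sweepForms_eq hE hN] at h
    cases hd : decision (nonnegForms k N) with
    | inl x => exact absurd ((decision_eq_inl hd).size_lt.trans_le hs) (Nat.not_lt_zero _)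
    | inr b =>
      rw [hd] at h
      exact ⟨b, [], _, decision_eq_inr hk hd, le_rfl,
        by rw [List.append_nil, List.length_reverse, length_sweep], h.mono (by lia)⟩
  | succ s ih =>
    have h := run_forward (k := k) [] word out X t n E hE hn (zeroCarry k) []
    rw [afterForward, sweepForms_eq hE hN, List.append_nil] at h
    cases hd : decision (nonnegForms k N) with
    | inl x =>
      rw [hd] at h
      have hx := decision_eq_inl hd
      have h' := h.trans (run_backward _ _ _ _ _ _ _)
      simp only [List.reverse_reverse, List.append_nil, List.length_reverse, length_sweep] at h'
      obtain ⟨b, w, aux, hb, hw, haux, hr⟩ := ih ((letterVal k x)⁻¹ * N)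
        (Nat.le_of_lt_succ (hx.size_lt.trans_le hs)) (some x) _ _ (x :: word)
        (fun i j => by rw [List.length_map, length_sweep])
        ⟨0, 0, by rw [List.length_map, length_sweep]⟩
        (by rw [toMatrix_sweep hE hN hsmall]; rfl)
        (fun i j => (hx.1 i j).trans_lt (hsmall i j))
      refine ⟨b, x :: w, aux, ?_, by simpa using hw, haux, ?_⟩
      · have := GreedyRun.left N x _ hx.size_lt hb
        cases b <;> simpa using this
      · rw [List.reverse_cons, List.append_assoc]
        exact (h'.trans hr).mono (by lia)
    | inr b =>
      rw [hd] at h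
      exact ⟨b, [], _, decision_eq_inr hk hd, Nat.zero_le _,
        by rw [List.length_reverse, length_sweep], h.mono (by nlinarith)⟩

/-! ### The running time -/

theorem natAbs_le_size (M : SL(2, ℤ)) (i j : Fin 2) : (M.1 i j).natAbs ≤ size M :=
  (Finset.single_le_sum (f := fun j => (M.1 i j).natAbs) (fun _ _ => Nat.zero_le _)
    (Finset.mem_univ j)).trans
    (Finset.single_le_sum (f := fun i => ∑ j : Fin 2, (M.1 i j).natAbs) (fun _ _ => Nat.zero_le _)
      (Finset.mem_univ i))

theorem two_le_size (M : SL(2, ℤ)) : 2 ≤ size M := by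
  have hdet : M.1 0 0 * M.1 1 1 - M.1 0 1 * M.1 1 0 = 1 := by
    rw [← Matrix.det_fin_two]; exact M.2
  simp only [size, Fin.sum_univ_two]
  by_contra! h
  have h1 : ∀ x y : ℤ, x = 0 ∨ y = 0 → x * y = 0 := by
    rintro x y (rfl | rfl) <;> simp
  rw [h1 (M.1 0 0) (M.1 1 1) (by lia), h1 (M.1 0 1) (M.1 1 0) (by lia)] at hdet
  simp at hdet

theorem two_pow_le_of_size_eq {n s m : ℕ} (hn : m.size = n) (hm : m ≤ s) (hs : 1 ≤ s) :
    2 ^ n ≤ 2 * s := by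
  cases n with
  | zero => simp; lia
  | succ n =>
    have : 2 ^ n ≤ m := Nat.lt_size.1 (by lia)
    rw [pow_succ]
    lia

theorem haltsWithin_machine {k : ℤ} {M : SL(2, ℤ)} {r : Option (List Letter)} {b : Bool} {n : ℕ}
    (h : ReachesIn k n (.readSign 0 0, stackList (encodeMatrix M) (fun _ _ => []) [] [] [])
      (.write b, stackList [] (fun _ _ => []) [] [] ((encodeResult r).tail)))
    (hr : (encodeResult r).head? = some (.inl b)) :
    HaltsWithin (machine k) M r (n + 1) := by
  obtain ⟨m, hm, s, hs⟩ := h .empty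
  refine ⟨⟨⟨m + 1, ?_⟩, by lia⟩⟩
  have hinit : initList (machine k).tm ((encodeMatrix M).map (machine k).inputAlphabet.symm) =
      ⟨some (.readSign 0 0), .empty, stackList (encodeMatrix M) (fun _ _ => []) [] [] []⟩ := by
    have : (encodeMatrix M).map (machine k).inputAlphabet.symm = encodeMatrix M := List.map_id _
    rw [this]
    refine congrArg (TM2.Cfg.mk _ _) ?_
    funext q
    cases q <;> rfl
  have hhalt : haltList (machine k).tm ((encodeResult r).map (machine k).outputAlphabet.symm) =
      ⟨none, .empty, stackList [] (fun _ _ => []) [] [] (encodeResult r)⟩ := by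
    have : (encodeResult r).map (machine k).outputAlphabet.symm = encodeResult r := List.map_id _
    rw [this]
    refine congrArg (TM2.Cfg.mk _ _) ?_
    funext q
    cases q <;> rfl
  rw [hinit, Option.map_some, hhalt, Function.iterate_succ_apply']
  refine (congrArg (flip bind (TM2.step (program k))) hs).trans ?_
  refine congrArg some ((stepAux_write_nil ..).trans ?_)
  exact congrArg (fun l => (⟨none, .empty, stackList [] (fun _ _ => []) [] [] l⟩ :
    TM2.Cfg StackIndex.Alphabet (Label (Carry k)) Register)) (List.eq_cons_of_mem_head? hr).symm

theorem exists_haltsWithin {k : ℤ} (hk : 2 ≤ k) (M : SL(2, ℤ)) :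
    ∃ (r : Option (List Letter)) (t n : ℕ), GreedyRun k M r ∧ HaltsWithin (machine k) M r t ∧
      2 ^ n ≤ 2 * size M ∧ t ≤ 2 * n * size M + 7 * n + 3 * size M + 12 := by
  obtain ⟨⟨i, j⟩, hmax⟩ := Finite.exists_max fun p : Fin 2 × Fin 2 => (M.1 p.1 p.2).natAbs.size
  obtain ⟨n, hn⟩ : ∃ n, (M.1 i j).natAbs.size = n := ⟨_, rfl⟩
  have hle : ∀ i j, (M.1 i j).natAbs.size ≤ n := fun i' j' => hn ▸ hmax (i', j')
  obtain ⟨b, w, aux, hG, hw, haux, hloop⟩ := run_loop hk n [] (size M) M le_rfl none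
    (fun _ _ => 0) (fun i j => intDigits (M.1 i j)) []
    (fun i j => (length_intDigits _).trans_le (hle i j)) ⟨i, j, (length_intDigits _).trans hn⟩
    (by
      ext i j
      simp [opMat, Digits.toMatrix, digitsVal_intDigits])
    (fun i j => by
      have := Nat.size_le.1 (hle i j)
      rw [Int.abs_eq_natAbs]
      exact_mod_cast this)
  have hrun := (((run_read [] [] [] M n hle).trans hloop).trans
    (run_erase _ _ _ _ _ _)).trans (run_write _ _ _ _ _ _)
  simp only [List.append_nil, List.reverse_reverse, List.length_reverse, haux] at hrun
  refine ⟨_, _, n, hG, haltsWithin_machine (b := b) (n := 4 * n + 8 + (size M + 1) * (2 * n + 2) +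
    (n + 1) + w.length) ?_ ?_,
    two_pow_le_of_size_eq hn (natAbs_le_size M i j) (by have := two_le_size M; lia), by nlinarith⟩
  · cases b <;> simpa [encodeResult] using hrun
  · cases b <;> rfl

theorem time_le {n s t : ℕ} (hs : 2 ≤ s) (hn : 2 ^ n ≤ 2 * s)
    (ht : t ≤ 2 * n * s + 7 * n + 3 * s + 12) : (t : ℝ) ≤ 40 * (s * Real.log s) := by
  have hs' : (2 : ℝ) ≤ s := by exact_mod_cast hs
  have h2 : (1 : ℝ) / 2 ≤ Real.log 2 := by linarith [Real.log_two_gt_d9]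
  have hl : Real.log 2 ≤ Real.log s := Real.log_le_log (by norm_num) hs'
  have hn' : (n : ℝ) * Real.log 2 ≤ Real.log 2 + Real.log s := by
    rw [← Real.log_pow, ← Real.log_mul (by norm_num) (by positivity)]
    exact Real.log_le_log (by positivity) (by exact_mod_cast hn)
  have hn4 : (n : ℝ) ≤ 4 * Real.log s := by
    have : (0 : ℝ) ≤ n := by positivity
    nlinarith
  have ht' : (t : ℝ) ≤ 2 * n * s + 7 * n + 3 * s + 12 := by exact_mod_cast ht
  nlinarith

end SanovMembership

theorem mainTheorem4 (k : ℤ) (hk : 2 ≤ k) :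
    (∀ (M : SL(2, ℤ)) (r : Option (List SanovMembership.Letter)),
      SanovMembership.GreedyRun k M r → SanovMembership.IsAnswer k M r) ∧
    ∃ (T : Turing.TM2ComputableAux Computability.Γ' (Bool ⊕ SanovMembership.Letter)) (C : ℝ),
      ∀ M : SL(2, ℤ), ∃ (r : Option (List SanovMembership.Letter)) (t : ℕ),
        SanovMembership.IsAnswer k M r ∧
        SanovMembership.GreedyRun k M r ∧
        SanovMembership.HaltsWithin T M r t ∧
        (t : ℝ) ≤ C * ((SanovMembership.size M : ℝ) * Real.log (SanovMembership.size M)) := by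
  refine ⟨fun M r h => h.isAnswer hk, SanovMembership.machine k, 40, fun M => ?_⟩
  obtain ⟨r, t, n, hG, hT, hn, ht⟩ := SanovMembership.exists_haltsWithin hk M
  exact ⟨r, t, hG.isAnswer hk, hG, hT,
    SanovMembership.time_le (SanovMembership.two_le_size M) hn ht⟩
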